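/- Let $q$ be an odd prime power, $A=\mathbb{F}_q[t]$, $k=\mathbb{F}_q(t)$ and $k_\infty=\mathbb{F}_q((1/t))$, with absolute value $\left|\sum_{i\le n}a_it^i\right|_\infty=q^n$ if $a_n\neq 0$ (and $|0|_\infty=0$), and with the additive character $$e\Big(\sum_{i\le n} a_it^i\Big)=\exp\Big(\frac{2\pi i}{p}\operatorname{Tr}_{\mathbb{F}_q/\mathbb{F}_p}(a_{-1})\Big),$$ where $p$ is the characteristic of $\mathbb{F}_q$. Let $\alpha\in A$ be a square-free polynomial which is of odd degree or whose leading coefficient is not a square in $\mathbb{F}_q$, let $K=k(\sqrt{\alpha})$, let $\mathbf{Tr}:K\to k$ be the trace, and let $\mathbb{A}=A+A\sqrt{\alpha}$ be the integral closure of $A$ in $K$. Denote by $|\cdot|_\infty$ also the (unique) extension of $|\cdot|_\infty$ from $k$ to $K$, and put $\mathbf{N}(x)=|x|_\infty^2$ for $x\in K$. Then there is a constant $C>0$ depending only on $q$ and $\deg\alpha$ such that for all integers $Q,N\ge 0$ and all complex numbers $(a_g)_{g\in\mathbb{A}}$, $$\sum_{\substack{f\in\mathbb{A}\setminus\{0\}\\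 \mathbf{N}(f)=q^Q}}\ \sum_{\substack{r \bmod f\\ (r,f)=1}}\ \Bigg|\sum_{\substack{g\in\mathbb{A}\\ \mathbf{N}(g)\le q^N}}a_g\, e\Big(\mathbf{Tr}\Big(\frac{gr}{2\sqrt{\alpha}\,f}\Big)\Big)\Bigg|^2\le C\,\big(q^{2Q}+q^N\big)\sum_{\substack{g\in\mathbb{A}\\ \mathbf{N}(g)\le q^N}}|a_g|^2 ,$$ where $r$ runs over any set of representatives of the residue classes modulo $f$ whose ideal $(r)$ is coprime to $(f)$; all the sums are finite. -/

import Mathlib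

open scoped Polynomial

noncomputable section

namespace QuadLargeSieve

/-- `k_∞ = F((1/t))`: Laurent series in the variable `1/t` over `F`. The coefficient of `t ^ i` of
`x` is `x.coeff (-i)`. -/
abbrev KInf (F : Type*) [Field F] : Type _ := LaurentSeries F

/-- The element `t` of `k_∞ = F((1/t))`. -/
def tInf (F : Type*) [Field F] : KInf F := HahnSeries.single (-1 : ℤ) (1 : F)

theorem tInf_pow (F : Type*) [Field F] (n : ℕ) :
    tInf F ^ n = HahnSeries.single (-(n : ℤ)) (1 : F) := by
  rw [tInf, HahnSeries.single_pow]
  simp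

/-- The embedding of `A = F[t]` into `k_∞ = F((1/t))`. -/
def polyToKInf (F : Type*) [Field F] : F[X] →+* KInf F :=
  Polynomial.eval₂RingHom (HahnSeries.C : F →+* HahnSeries ℤ F) (tInf F)

theorem coeff_polyToKInf (F : Type*) [Field F] (f : F[X]) (n : ℕ) :
    (polyToKInf F f).coeff (-(n : ℤ)) = f.coeff n := by
  induction f using Polynomial.induction_on' with
  | add p q hp hq => rw [map_add, HahnSeries.coeff_add, hp, hq, Polynomial.coeff_add]
  | monomial m a =>
    have h1 : polyToKInf F (Polynomial.monomial m a) = HahnSeries.single (-(m : ℤ)) a := by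
      rw [polyToKInf, Polynomial.coe_eval₂RingHom, Polynomial.eval₂_monomial, tInf_pow,
        HahnSeries.C_apply, HahnSeries.single_mul_single, zero_add, mul_one]
    rw [h1, HahnSeries.coeff_single, Polynomial.coeff_monomial]
    by_cases h : m = n
    · simp [h]
    · have h' : n ≠ m := fun h' => h h'.symm
      simp [h, h']

theorem polyToKInf_injective (F : Type*) [Field F] : Function.Injective (polyToKInf F) := by
  intro f g h
  ext n
  rw [← coeff_polyToKInf, ← coeff_polyToKInf, h]

/-- The embedding of `k = F(t)` into `k_∞ = F((1/t))`: the field homomorphism that is the identity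
on `F` and sends `t` to `t`. -/
def toKInf (F : Type*) [Field F] : RatFunc F →+* KInf F :=
  IsFractionRing.lift (A := F[X]) (K := RatFunc F) (polyToKInf_injective F)

/-- The absolute value on `k_∞`: it is `q ^ n` at `∑_{i ≤ n} a_i t ^ i` with `a_n ≠ 0`, where
`q` is the number of elements of `F`, and `0` at `0`. -/
def absInf (F : Type*) [Field F] (x : KInf F) : ℝ :=
  open Classical in if x = 0 then 0 else (Nat.card F : ℝ) ^ (-x.order)

/-- The additive character `E(x) = exp((2πi/p) Tr(x))` of the finite field `F` of characteristic
`p`, with `Tr : F → 𝔽_p` the absolute trace. -/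
def charE (F : Type*) [Field F] (x : F) : ℂ :=
  letI : Algebra (ZMod (ringChar F)) F := ZMod.algebra F (ringChar F)
  Complex.exp (2 * Real.pi * Complex.I / (ringChar F : ℂ) *
    ((Algebra.trace (ZMod (ringChar F)) F x).val : ℂ))

/-- The additive character `e(∑ a_i t ^ i) = E(a_{-1})` of `k_∞`. -/
def charInf (F : Type*) [Field F] (x : KInf F) : ℂ := charE F (x.coeff 1)

section Quadratic

variable (F : Type*) [Field F] (K : Type*) [Field K] [Algebra F[X] K]

/-- The ring of integers `𝔸` of `K`: the integral closure of `A = F[t]` in `K`. -/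
abbrev Integers : Type _ := integralClosure F[X] K

variable {F K}

/-- `N(x) = |x|_∞ ^ 2`, where `v = |·|_∞`. -/
def sizeN (v : AbsoluteValue K ℝ) (x : K) : ℝ := v x ^ 2

variable (F)

/-- The set of moduli `{f ∈ 𝔸 ∖ {0} : N(f) = q ^ Q}`. -/
def moduli (v : AbsoluteValue K ℝ) (Q : ℕ) : Set (Integers F K) :=
  {f | f ≠ 0 ∧ sizeN v (f : K) = (Nat.card F : ℝ) ^ Q}

/-- The set `B(0, N) ∩ 𝔸 = {g ∈ 𝔸 : N(g) ≤ q ^ N}`. -/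
def ballInt (v : AbsoluteValue K ℝ) (N : ℕ) : Set (Integers F K) :=
  {g | sizeN v (g : K) ≤ (Nat.card F : ℝ) ^ N}

end Quadratic

/-- `S` is a set of representatives of the residue classes `r mod f` with `(r, f) = 1`, the
coprimality being that of the ideals `(r)` and `(f)`. -/
def IsReducedResidueSystem {R : Type*} [CommRing R] (f : R) (S : Set R) : Prop :=
  (∀ r ∈ S, IsCoprime r f) ∧ ∀ x : R, IsCoprime x f → ∃! r, r ∈ S ∧ f ∣ x - r

end QuadLargeSieve

end

/-! Write $l=\deg\alpha$. Each pair $(f,r)$ gives a character $g\mapsto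
e(\mathbf{Tr}(gr/(2\sqrt\alpha f)))$ of the finite additive group $G=\{g\in\mathbb A:\mathbf N(g)\le
q^{N'}\}$, where $N'=\max(N,2Q+5l)$ and $a$ is extended by zero. Parseval over the whole dual of $G$
bounds the left side by $M\,|G|\sum|a_g|^2$, where $M$ bounds how often a character occurs
(`sum_norm_sq_sum_mul_le`).

To bound $M$: if $r/f$ and $r'/f'$ give the same character, duality puts their difference very close
to some $w\in\mathbb A$ (`exists_abs_sub_sq_mul_le`). Multiplying by $ff'$ gives an element of
$\mathbb A$ too small to be nonzero, so the fractions agree modulo $\mathbb A$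
(`exists_mul_sub_mul_eq`). Coprimality then gives $f\mid f'$ with a quotient of norm 1, and $f'$
determines $r'$; so $M$ is at most the number of elements of norm at most 1.

The geometry rests on $|U+W\sqrt\alpha|\ge\max(|U|,|W\sqrt\alpha|)$ (`max_le_abs_add_mul`). Integral
elements are only placed in $\alpha^{-1}(A+A\sqrt\alpha)$, which costs powers of $q^l$ in the
constant. -/

namespace QuadLargeSieve

/-! ### The additive character of the finite field -/

section FiniteFieldCharacter

variable (F : Type*) [Field F] [Finite F]

/-- It is the standard character of $\mathbb Z/p$ composed with the trace; nondegeneracy of the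
trace form makes it nontrivial. -/
theorem exists_addChar_eq_charE :
    ∃ ψ : AddChar F ℂ, (∀ x, ψ x = charE F x) ∧ ∃ x, ψ x ≠ 1 := by
  let _ : Algebra (ZMod (ringChar F)) F := ZMod.algebra F (ringChar F)
  have : NeZero (ringChar F) := ⟨CharP.ringChar_ne_zero_of_finite F⟩
  refine ⟨(ZMod.stdAddChar (N := ringChar F)).compAddMonoidHom
    (Algebra.trace (ZMod (ringChar F)) F).toAddMonoidHom, fun x => ?_, ?_⟩
  · rw [AddChar.compAddMonoidHom_apply, ZMod.stdAddChar_apply, ZMod.toCircle_apply, charE]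
    congr 1
    simp only [LinearMap.toAddMonoidHom_coe]
    ring
  · obtain ⟨b, hb⟩ := FiniteField.trace_to_zmod_nondegenerate F (one_ne_zero (α := F))
    refine ⟨1 * b, fun h => hb ?_⟩
    apply ZMod.injective_stdAddChar
    rw [AddChar.map_zero_eq_one]
    exact h

theorem charE_zero : charE F 0 = 1 := by
  obtain ⟨ψ, h, -⟩ := exists_addChar_eq_charE F
  rw [← h, AddChar.map_zero_eq_one]

theorem charE_add (x y : F) : charE F (x + y) = charE F x * charE F y := by
  obtain ⟨ψ, h, -⟩ := exists_addChar_eq_charE F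
  simp only [← h, AddChar.map_add_eq_mul]

variable {F}

theorem eq_zero_of_forall_charE_mul_eq_one {x : F} (h : ∀ c, charE F (c * x) = 1) : x = 0 := by
  by_contra hx
  obtain ⟨ψ, hψ, y, hy⟩ := exists_addChar_eq_charE F
  apply hy
  rw [hψ, ← h (y / x), div_mul_cancel₀ _ hx]

end FiniteFieldCharacter

/-! ### Laurent series in $1/t$ and their polynomial parts -/

section Laurent

variable {F : Type*} [Field F]

theorem charInf_zero [Finite F] : charInf F 0 = 1 := by
  rw [charInf, HahnSeries.coeff_zero, charE_zero]

theorem charInf_add [Finite F] (x y : KInf F) :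
    charInf F (x + y) = charInf F x * charInf F y := by
  rw [charInf, HahnSeries.coeff_add, charE_add, charInf, charInf]

theorem toKInf_algebraMap (f : F[X]) : toKInf F (algebraMap F[X] (RatFunc F) f) = polyToKInf F f :=
  IsFractionRing.lift_algebraMap _ _

theorem polyToKInf_monomial (m : ℕ) (c : F) :
    polyToKInf F (Polynomial.monomial m c) = HahnSeries.single (-(m : ℤ)) c := by
  rw [polyToKInf, Polynomial.coe_eval₂RingHom, Polynomial.eval₂_monomial, tInf_pow,
    HahnSeries.C_apply, HahnSeries.single_mul_single, zero_add, mul_one]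

theorem coeff_polyToKInf_of_pos (f : F[X]) {i : ℤ} (hi : 0 < i) : (polyToKInf F f).coeff i = 0 := by
  induction f using Polynomial.induction_on' with
  | add p q hp hq => rw [map_add, HahnSeries.coeff_add, hp, hq, add_zero]
  | monomial m a =>
    rw [polyToKInf_monomial, HahnSeries.coeff_single_of_ne (by omega)]

theorem order_polyToKInf {f : F[X]} (hf : f ≠ 0) :
    (polyToKInf F f).order = -(f.natDegree : ℤ) := by
  have h0 : polyToKInf F f ≠ 0 := (map_ne_zero_iff _ (polyToKInf_injective F)).2 hf
  apply le_antisymm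
  · apply HahnSeries.order_le_of_coeff_ne_zero
    rw [coeff_polyToKInf]
    exact Polynomial.leadingCoeff_ne_zero.2 hf
  · by_contra! hlt
    have h1 := HahnSeries.coeff_order_eq_zero.not.2 h0
    obtain ⟨n, hn⟩ : ∃ n : ℕ, (polyToKInf F f).order = -(n : ℤ) :=
      ⟨(-(polyToKInf F f).order).toNat, by omega⟩
    rw [hn, coeff_polyToKInf] at h1
    have := Polynomial.le_natDegree_of_ne_zero h1
    omega

theorem absInf_polyToKInf {f : F[X]} (hf : f ≠ 0) :
    absInf F (polyToKInf F f) = (Nat.card F : ℝ) ^ f.natDegree := by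
  have h0 : polyToKInf F f ≠ 0 := (map_ne_zero_iff _ (polyToKInf_injective F)).2 hf
  rw [absInf, if_neg h0, order_polyToKInf hf, neg_neg, zpow_natCast]

theorem absInf_le_of_coeff_eq_zero [Finite F] {x : KInf F} {J : ℤ}
    (h : ∀ i ≤ J, x.coeff i = 0) : absInf F x ≤ (Nat.card F : ℝ) ^ (-(J + 1)) := by
  have hq : (1 : ℝ) ≤ Nat.card F := by exact_mod_cast Nat.card_pos
  rw [absInf]
  split_ifs with hx
  · positivity
  · apply zpow_le_zpow_right₀ hq
    by_contra! hlt
    exact HahnSeries.coeff_order_eq_zero.not.2 hx (h _ (by omega))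

/-- Every Laurent series in `1/t` has a polynomial part. -/
theorem exists_coeff_polyToKInf_eq (x : KInf F) :
    ∃ f : F[X], ∀ i ≤ 0, (polyToKInf F f).coeff i = x.coeff i := by
  refine ⟨∑ n ∈ Finset.range ((-x.order).toNat + 1), Polynomial.monomial n (x.coeff (-(n : ℤ))),
    fun i hi => ?_⟩
  obtain ⟨n, rfl⟩ : ∃ n : ℕ, i = -(n : ℤ) := ⟨(-i).toNat, by omega⟩
  rw [coeff_polyToKInf, Polynomial.finsetSum_coeff]
  simp only [Polynomial.coeff_monomial]
  rw [Finset.sum_ite_eq' (Finset.range _) n]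
  split_ifs with hn
  · rfl
  · rw [Finset.mem_range] at hn
    exact (HahnSeries.coeff_eq_zero_of_lt_order (by omega)).symm

/-- If `e (c t ^ j x) = 1` for all constants `c` and all `j < J`, then `x` is
within `q ^ (-J - 1)` of a polynomial. -/
theorem exists_absInf_sub_le [Finite F] {x : KInf F} {J : ℕ}
    (h : ∀ j < J, ∀ c, charInf F (polyToKInf F (Polynomial.monomial j c) * x) = 1) :
    ∃ f : F[X], absInf F (x - polyToKInf F f) ≤ (Nat.card F : ℝ) ^ (-((J : ℤ) + 1)) := by
  obtain ⟨f, hf⟩ := exists_coeff_polyToKInf_eq x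
  refine ⟨f, absInf_le_of_coeff_eq_zero fun i hi => ?_⟩
  rw [HahnSeries.coeff_sub]
  rcases le_or_gt i 0 with h0 | h0
  · rw [hf i h0, sub_self]
  · rw [coeff_polyToKInf_of_pos f h0, sub_zero]
    -- Multiplying by $ct^{i-1}$ moves the coefficient of $t^{-i}$ to $t^{-1}$, where the character
    -- reads it; $1\le i\le J$ matches the exponents $j<J$.
    apply eq_zero_of_forall_charE_mul_eq_one
    intro c
    have := h (i - 1).toNat (by omega) c
    rwa [charInf, polyToKInf_monomial, HahnSeries.coeff_single_mul,
      show (1 : ℤ) - -((i - 1).toNat : ℤ) = i by omega] at this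

end Laurent

/-! ### Parseval and the large sieve on a finite abelian group -/

section LargeSieve

variable {G : Type*} [AddCommGroup G] [Fintype G]

/-- Parseval's identity on a finite abelian group. -/
theorem sum_norm_sq_sum_mul_addChar (b : G → ℂ) :
    ∑ ψ : AddChar G ℂ, ‖∑ g, b g * ψ g‖ ^ 2 = Fintype.card G * ∑ g, ‖b g‖ ^ 2 := by
  classical
  have hC : ∑ ψ : AddChar G ℂ, ((∑ g, b g * ψ g) * (starRingEnd ℂ) (∑ g, b g * ψ g)) =
      Fintype.card G * ∑ g, b g * (starRingEnd ℂ) (b g) := by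
    have h1 : ∀ ψ : AddChar G ℂ, (∑ g, b g * ψ g) * (starRingEnd ℂ) (∑ g, b g * ψ g) =
        ∑ g, ∑ g', b g * (starRingEnd ℂ) (b g') * ψ (g - g') := by
      intro ψ
      rw [map_sum, Finset.sum_mul_sum]
      refine Finset.sum_congr rfl fun g _ => Finset.sum_congr rfl fun g' _ => ?_
      rw [map_mul, sub_eq_add_neg, AddChar.map_add_eq_mul, AddChar.map_neg_eq_conj]
      ring
    simp_rw [h1]
    rw [Finset.sum_comm, Finset.mul_sum]
    refine Finset.sum_congr rfl fun g _ => ?_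
    -- Summing over $\psi$ first, orthogonality leaves only the diagonal $g=g'$.
    rw [Finset.sum_comm]
    simp_rw [← Finset.mul_sum, AddChar.sum_apply_eq_ite, sub_eq_zero]
    simp
    ring
  simp only [Complex.mul_conj, Complex.normSq_eq_norm_sq] at hC
  exact_mod_cast hC

/-- The large sieve inequality for a family of characters, each of which occurs at most `M`
times. -/
theorem sum_norm_sq_sum_mul_le {ι : Type*} (T : Finset ι) (ψ : ι → AddChar G ℂ) (M : ℕ)
    (hM : ∀ i ∈ T, Set.ncard {j ∈ (T : Set ι) | ψ j = ψ i} ≤ M) (b : G → ℂ) :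
    ∑ i ∈ T, ‖∑ g, b g * ψ i g‖ ^ 2 ≤ M * (Fintype.card G * ∑ g, ‖b g‖ ^ 2) := by
  classical
  rw [← sum_norm_sq_sum_mul_addChar, Finset.mul_sum,
    ← Finset.sum_fiberwise T ψ fun i => ‖∑ g, b g * ψ i g‖ ^ 2]
  refine Finset.sum_le_sum fun χ _ => ?_
  rw [Finset.sum_congr rfl (g := fun _ => ‖∑ g, b g * χ g‖ ^ 2)
    fun i hi => by rw [(Finset.mem_filter.1 hi).2], Finset.sum_const, nsmul_eq_mul]
  refine mul_le_mul_of_nonneg_right ?_ (by positivity)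
  rcases (T.filter fun i => ψ i = χ).eq_empty_or_nonempty with h | ⟨i, hi⟩
  · simp [h]
  · obtain ⟨hiT, rfl⟩ := Finset.mem_filter.1 hi
    have := hM i hiT
    rw [← Set.ncard_coe_finset]
    simpa using this

end LargeSieve

/-! ### Geometry and trace of the imaginary quadratic extension -/

/-- `K = k(√α)` is an imaginary quadratic extension of `k = F(t)` with `s = √α`, and `v` is an
absolute value on `K` that extends `|·|_∞`. -/
structure IsImaginaryQuadratic {F : Type*} [Field F] {K : Type*} [Field K] [Algebra F[X] K]
    [Algebra (RatFunc F) K] (α : F[X]) (s : K) (v : AbsoluteValue K ℝ) : Prop where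
  two_ne_zero : (2 : F) ≠ 0
  ne_zero : α ≠ 0
  odd_or_not_isSquare : Odd α.natDegree ∨ ¬ IsSquare α.leadingCoeff
  sq_eq : s ^ 2 = algebraMap F[X] K α
  adjoin_eq_top : IntermediateField.adjoin (RatFunc F) {s} = ⊤
  abs_algebraMap : ∀ x : RatFunc F, v (algebraMap (RatFunc F) K x) = absInf F (toKInf F x)

/-- The leading terms of $U^2$ and $\alpha W^2$ cannot cancel: for nonzero $U,W$, equal degrees
force $\deg\alpha$ to be even, and cancellation would then make the leading coefficient of $\alpha$
a square. -/
theorem degree_le_degree_sq_sub {F : Type*} [Field F] {α : F[X]} (hα : α ≠ 0)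
    (him : Odd α.natDegree ∨ ¬ IsSquare α.leadingCoeff) (U W : F[X]) :
    (U ^ 2).degree ≤ (U ^ 2 - α * W ^ 2).degree ∧
      (α * W ^ 2).degree ≤ (U ^ 2 - α * W ^ 2).degree := by
  rcases lt_trichotomy (U ^ 2).degree (α * W ^ 2).degree with h | h | h
  · rw [Polynomial.degree_sub_eq_right_of_degree_lt h]
    exact ⟨h.le, le_rfl⟩
  · rw [← h, and_self]
    rcases eq_or_ne U 0 with rfl | hU
    · simp
    have hW : W ≠ 0 := by
      rintro rfl
      rw [zero_pow two_ne_zero, mul_zero, Polynomial.degree_zero, Polynomial.degree_eq_bot] at h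
      exact hU (pow_eq_zero_iff two_ne_zero |>.1 h)
    have hn := Polynomial.natDegree_eq_natDegree h
    rw [Polynomial.natDegree_mul hα (pow_ne_zero _ hW), Polynomial.natDegree_pow,
      Polynomial.natDegree_pow] at hn
    have hsq : ¬ IsSquare α.leadingCoeff := him.resolve_left fun ⟨m, hm⟩ => by omega
    rw [Polynomial.degree_eq_natDegree (pow_ne_zero 2 hU)]
    apply Polynomial.le_degree_of_ne_zero
    intro h0
    apply hsq
    have h1 : (α * W ^ 2).coeff (U ^ 2).natDegree = α.leadingCoeff * W.leadingCoeff ^ 2 := by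
      rw [Polynomial.natDegree_eq_natDegree h, Polynomial.coeff_natDegree,
        Polynomial.leadingCoeff_mul, Polynomial.leadingCoeff_pow]
    rw [Polynomial.coeff_sub, h1, Polynomial.coeff_natDegree, Polynomial.leadingCoeff_pow,
      sub_eq_zero] at h0
    have hW' := Polynomial.leadingCoeff_ne_zero.2 hW
    refine ⟨U.leadingCoeff / W.leadingCoeff, ?_⟩
    field_simp
    exact h0.symm
  · rw [Polynomial.degree_sub_eq_left_of_degree_lt h]
    exact ⟨le_rfl, h.le⟩

theorem card_degreeLT {F : Type*} [Field F] (n : ℕ) :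
    Nat.card (Polynomial.degreeLT F n) = Nat.card F ^ n := by
  rw [Nat.card_congr (Polynomial.degreeLTEquiv F n).toEquiv, Nat.card_fun, Nat.card_fin]

namespace IsImaginaryQuadratic

variable {F : Type*} [Field F] {K : Type*} [Field K] [Algebra (RatFunc F) K]

theorem trace_algebraMap_mul (x : RatFunc F) (y : K) :
    Algebra.trace (RatFunc F) K (algebraMap (RatFunc F) K x * y) =
      x * Algebra.trace (RatFunc F) K y := by
  rw [← Algebra.smul_def, map_smul, smul_eq_mul]

variable [Algebra F[X] K] {α : F[X]} {s : K} {v : AbsoluteValue K ℝ}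

theorem isIntegral_sqrt (h : IsImaginaryQuadratic α s v) : IsIntegral F[X] s :=
  ⟨Polynomial.X ^ 2 - Polynomial.C α, Polynomial.monic_X_pow_sub_C _ _root_.two_ne_zero,
    by simp [h.sq_eq]⟩

theorem two_ne_zero_ratFunc (h : IsImaginaryQuadratic α s v) : (2 : RatFunc F) ≠ 0 := by
  rw [← map_ofNat (algebraMap F (RatFunc F)) 2]
  exact (map_ne_zero _).2 h.two_ne_zero

theorem two_ne_zero_field (h : IsImaginaryQuadratic α s v) : (2 : K) ≠ 0 := by
  rw [← map_ofNat (algebraMap (RatFunc F) K) 2]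
  exact (map_ne_zero _).2 h.two_ne_zero_ratFunc

variable [IsScalarTower F[X] (RatFunc F) K]

theorem algebraMap_injective_poly : Function.Injective (algebraMap F[X] K) := by
  rw [IsScalarTower.algebraMap_eq F[X] (RatFunc F) K]
  exact (algebraMap (RatFunc F) K).injective.comp (IsFractionRing.injective F[X] (RatFunc F))

theorem algebraMap_ne_zero (h : IsImaginaryQuadratic α s v) : algebraMap F[X] K α ≠ 0 :=
  (map_ne_zero_iff _ algebraMap_injective_poly).2 h.ne_zero

theorem sq_eq_ratFunc (h : IsImaginaryQuadratic α s v) :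
    s ^ 2 = algebraMap (RatFunc F) K (algebraMap F[X] (RatFunc F) α) := by
  rw [h.sq_eq, IsScalarTower.algebraMap_apply F[X] (RatFunc F) K]

theorem abs_poly (h : IsImaginaryQuadratic α s v) {f : F[X]} (hf : f ≠ 0) :
    v (algebraMap F[X] K f) = (Nat.card F : ℝ) ^ f.natDegree := by
  rw [IsScalarTower.algebraMap_apply F[X] (RatFunc F) K, h.abs_algebraMap, toKInf_algebraMap,
    absInf_polyToKInf hf]

theorem abs_sqrt_sq (h : IsImaginaryQuadratic α s v) :
    v s ^ 2 = (Nat.card F : ℝ) ^ α.natDegree := by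
  rw [← map_pow, h.sq_eq, h.abs_poly h.ne_zero]

theorem exists_eq_add_mul (h : IsImaginaryQuadratic α s v) (x : K) :
    ∃ a b : RatFunc F, x = algebraMap (RatFunc F) K a + algebraMap (RatFunc F) K b * s := by
  have hint : IsIntegral (RatFunc F) s := h.isIntegral_sqrt.tower_top
  have hx : x ∈ (IntermediateField.adjoin (RatFunc F) {s}).toSubalgebra := by
    rw [h.adjoin_eq_top]; trivial
  rw [IntermediateField.adjoin_simple_toSubalgebra_of_isAlgebraic hint.isAlgebraic] at hx
  induction hx using Algebra.adjoin_induction with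
  | mem y hy =>
    rw [Set.mem_singleton_iff] at hy
    exact ⟨0, 1, by simp [hy]⟩
  | algebraMap r => exact ⟨r, 0, by simp⟩
  | add y z _ _ hy hz =>
    obtain ⟨a, b, rfl⟩ := hy
    obtain ⟨c, d, rfl⟩ := hz
    exact ⟨a + c, b + d, by simp only [map_add]; ring⟩
  | mul y z _ _ hy hz =>
    obtain ⟨a, b, rfl⟩ := hy
    obtain ⟨c, d, rfl⟩ := hz
    refine ⟨a * c + b * d * algebraMap F[X] (RatFunc F) α, a * d + b * c, ?_⟩
    simp only [map_add, map_mul, ← h.sq_eq_ratFunc]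
    ring

variable [Finite F]

theorem one_lt_card : (1 : ℝ) < Nat.card F := by exact_mod_cast Finite.one_lt_card

theorem one_le_card : (1 : ℝ) ≤ Nat.card F := one_lt_card.le

theorem abs_poly_le (h : IsImaginaryQuadratic α s v) {f g : F[X]} (hfg : f.degree ≤ g.degree) :
    v (algebraMap F[X] K f) ≤ v (algebraMap F[X] K g) := by
  rcases eq_or_ne f 0 with rfl | hf
  · simp
  · have hg : g ≠ 0 := by
      rintro rfl
      simp [hf] at hfg
    rw [h.abs_poly hf, h.abs_poly hg]
    exact pow_le_pow_right₀ one_le_card (Polynomial.natDegree_le_natDegree hfg)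

theorem abs_natCast_le (h : IsImaginaryQuadratic α s v) (n : ℕ) : v (n : K) ≤ 1 := by
  have := h.abs_poly_le (f := (n : F[X])) (g := 1)
    (by rw [Polynomial.degree_one]; exact Polynomial.degree_natCast_le n)
  simpa using this

/-- Natural numbers are constants of $A$, hence have absolute value at most 1, and a norm with this
property is ultrametric. -/
theorem abs_add_le_max (h : IsImaginaryQuadratic α s v) (x y : K) :
    v (x + y) ≤ max (v x) (v y) := by
  let _ : NormedField K := v.toNormedField
  have : IsUltrametricDist K :=
    IsUltrametricDist.isUltrametricDist_of_forall_norm_natCast_le_one h.abs_natCast_le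
  exact IsUltrametricDist.norm_add_le_max x y

theorem abs_sub_le_max (h : IsImaginaryQuadratic α s v) (x y : K) :
    v (x - y) ≤ max (v x) (v y) := by
  simpa [sub_eq_add_neg] using h.abs_add_le_max x (-y)

theorem one_le_abs_sqrt (h : IsImaginaryQuadratic α s v) : 1 ≤ v s := by
  have := one_le_pow₀ (one_le_card (F := F)) (n := α.natDegree)
  rw [← h.abs_sqrt_sq] at this
  exact (one_le_sq_iff₀ (v.nonneg s)).1 this

/-- The product $(u+ws)(u-ws)$ is the norm form, of size at least the square of the maximum since
nothing cancels; the factor $u-ws$ is at most the maximum by the ultrametric inequality. Divide. -/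
theorem max_le_abs_add_mul (h : IsImaginaryQuadratic α s v) (U W : F[X]) :
    max (v (algebraMap F[X] K U)) (v (algebraMap F[X] K W * s)) ≤
      v (algebraMap F[X] K U + algebraMap F[X] K W * s) := by
  set u := algebraMap F[X] K U with hu
  set w := algebraMap F[X] K W with hw
  have hprod : v (u + w * s) * v (u - w * s) = v (algebraMap F[X] K (U ^ 2 - α * W ^ 2)) := by
    rw [← map_mul, map_sub, map_pow, map_mul (algebraMap F[X] K), map_pow, ← hu, ← hw, ← h.sq_eq]
    ring_nf
  obtain ⟨h1, h2⟩ := degree_le_degree_sq_sub h.ne_zero h.odd_or_not_isSquare U W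
  have h1 := h.abs_poly_le h1
  have h2 := h.abs_poly_le h2
  rw [← hprod, map_pow, map_pow, ← hu] at h1
  rw [← hprod, map_mul, map_pow, ← h.sq_eq, ← hw, ← mul_pow, map_pow, mul_comm s] at h2
  have h3 : max (v u) (v (w * s)) ^ 2 ≤ v (u + w * s) * v (u - w * s) := by
    rcases max_choice (v u) (v (w * s)) with hm | hm <;> rw [hm] <;> assumption
  have h4 := h.abs_sub_le_max u (w * s)
  have h0 : 0 ≤ max (v u) (v (w * s)) := le_max_of_le_left (v.nonneg u)
  rcases h0.eq_or_lt with h0 | h0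
  · rw [← h0]; exact v.nonneg _
  · have := h3.trans (mul_le_mul_of_nonneg_left h4 (v.nonneg _))
    rw [sq] at this
    exact le_of_mul_le_mul_right this h0

theorem eq_zero_of_add_mul_eq_zero (h : IsImaginaryQuadratic α s v) {U W : F[X]}
    (h0 : algebraMap F[X] K U + algebraMap F[X] K W * s = 0) : W = 0 := by
  have := (le_max_right _ _).trans (h.max_le_abs_add_mul U W)
  rw [h0, map_zero, map_mul] at this
  have hs := h.one_le_abs_sqrt
  have hw : v (algebraMap F[X] K W) = 0 := by nlinarith [v.nonneg (algebraMap F[X] K W)]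
  rw [AbsoluteValue.eq_zero] at hw
  exact (map_eq_zero_iff _ algebraMap_injective_poly).1 hw

theorem ne_algebraMap (h : IsImaginaryQuadratic α s v) (r : RatFunc F) :
    algebraMap (RatFunc F) K r ≠ s := by
  intro hr
  have hd := r.denom_ne_zero
  apply hd
  apply h.eq_zero_of_add_mul_eq_zero (U := -r.num)
  have hd' : algebraMap F[X] (RatFunc F) r.denom ≠ 0 := by simpa using hd
  rw [← hr, map_neg, neg_add_eq_zero, IsScalarTower.algebraMap_apply F[X] (RatFunc F) K,
    IsScalarTower.algebraMap_apply F[X] (RatFunc F) K r.denom, ← map_mul]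
  congr 1
  exact ((div_eq_iff hd').1 r.num_div_denom).trans (mul_comm _ _)

theorem minpoly_sqrt (h : IsImaginaryQuadratic α s v) :
    minpoly (RatFunc F) s = Polynomial.X ^ 2 - Polynomial.C (algebraMap F[X] (RatFunc F) α) := by
  symm
  apply minpoly.eq_of_irreducible_of_monic
  · refine X_pow_sub_C_irreducible_of_prime Nat.prime_two fun r hr => ?_
    have h1 : s ^ 2 = (algebraMap (RatFunc F) K r) ^ 2 := by
      rw [h.sq_eq_ratFunc, ← hr, map_pow]
    rcases sq_eq_sq_iff_eq_or_eq_neg.1 h1 with h2 | h2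
    · exact h.ne_algebraMap r h2.symm
    · exact h.ne_algebraMap (-r) (by rw [map_neg, h2])
  · simp [h.sq_eq_ratFunc]
  · exact Polynomial.monic_X_pow_sub_C _ _root_.two_ne_zero

theorem finrank_eq_two (h : IsImaginaryQuadratic α s v) : Module.finrank (RatFunc F) K = 2 := by
  rw [← IntermediateField.finrank_top', ← h.adjoin_eq_top,
    IntermediateField.adjoin.finrank h.isIntegral_sqrt.tower_top, h.minpoly_sqrt,
    Polynomial.natDegree_X_pow_sub_C]

theorem finiteDimensional (h : IsImaginaryQuadratic α s v) : FiniteDimensional (RatFunc F) K :=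
  FiniteDimensional.of_finrank_pos (by rw [h.finrank_eq_two]; norm_num)

theorem trace_algebraMap (h : IsImaginaryQuadratic α s v) (x : RatFunc F) :
    Algebra.trace (RatFunc F) K (algebraMap (RatFunc F) K x) = 2 * x := by
  rw [Algebra.trace_algebraMap, h.finrank_eq_two, nsmul_eq_mul, Nat.cast_ofNat]

theorem trace_sqrt (h : IsImaginaryQuadratic α s v) : Algebra.trace (RatFunc F) K s = 0 := by
  have := h.finiteDimensional
  rw [trace_eq_finrank_mul_minpoly_nextCoeff, h.minpoly_sqrt,
    Polynomial.nextCoeff_of_natDegree_pos (by rw [Polynomial.natDegree_X_pow_sub_C]; norm_num),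
    Polynomial.natDegree_X_pow_sub_C]
  simp

theorem sqrt_ne_zero (h : IsImaginaryQuadratic α s v) : s ≠ 0 := by
  rintro rfl
  exact h.ne_algebraMap 0 (map_zero _)

/-- The basis $(s/(2s),1/(2s))$ is trace-dual to $(1,s)$. This explains the $2\sqrt\alpha$ in the
exponential: traces of $x/(2s)$ against $1$ and $s$ read off the coordinates of $x$. -/
theorem add_mul_eq (h : IsImaginaryQuadratic α s v) (x : K) :
    x = algebraMap (RatFunc F) K (Algebra.trace (RatFunc F) K (s * (x / (2 * s)))) +
      algebraMap (RatFunc F) K (Algebra.trace (RatFunc F) K (x / (2 * s))) * s := by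
  obtain ⟨a, b, rfl⟩ := h.exists_eq_add_mul x
  have hs := h.sqrt_ne_zero
  have h2 := h.two_ne_zero_field
  have h2' := h.two_ne_zero_ratFunc
  have hα : algebraMap F[X] (RatFunc F) α ≠ 0 := by simpa using h.ne_zero
  have e1 : s * ((algebraMap (RatFunc F) K a + algebraMap (RatFunc F) K b * s) / (2 * s)) =
      algebraMap (RatFunc F) K (a / 2) + algebraMap (RatFunc F) K (b / 2) * s := by
    simp only [map_div₀, map_ofNat]
    field_simp
  have e2 : (algebraMap (RatFunc F) K a + algebraMap (RatFunc F) K b * s) / (2 * s) =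
      algebraMap (RatFunc F) K (b / 2) +
        algebraMap (RatFunc F) K (a / (2 * algebraMap F[X] (RatFunc F) α)) * s := by
    simp only [map_div₀, map_ofNat, map_mul, ← h.sq_eq_ratFunc]
    field_simp
    ring
  rw [e1, e2]
  simp only [map_add, h.trace_algebraMap, trace_algebraMap_mul, h.trace_sqrt, mul_zero, add_zero]
  rw [mul_div_cancel₀ _ h2', mul_div_cancel₀ _ h2']

/-- Up to the factor `α`, an integral element lies in `A + A √α`. -/
theorem exists_algebraMap_mul_eq (h : IsImaginaryQuadratic α s v) (g : Integers F K) :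
    ∃ U W : F[X], algebraMap F[X] K α * (g : K) =
      algebraMap F[X] K U + algebraMap F[X] K W * s := by
  have := h.finiteDimensional
  have htr : ∀ x : K, IsIntegral F[X] x →
      ∃ U : F[X], algebraMap F[X] (RatFunc F) U = Algebra.trace (RatFunc F) K x := fun x hx =>
    IsIntegrallyClosed.isIntegral_iff.1 (Algebra.isIntegral_trace hx)
  obtain ⟨U, hU⟩ := htr _ g.2
  obtain ⟨W, hW⟩ := htr _ (h.isIntegral_sqrt.mul g.2)
  have h2 := h.two_ne_zero_field
  have hc : (Polynomial.C (2⁻¹ : F)) * 2 = 1 := by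
    rw [show (2 : F[X]) = Polynomial.C 2 from rfl, ← Polynomial.C_mul,
      inv_mul_cancel₀ h.two_ne_zero, Polynomial.C_1]
  have hc' : algebraMap F[X] K (Polynomial.C (2⁻¹ : F)) = 2⁻¹ := by
    apply eq_inv_of_mul_eq_one_left
    simpa only [map_mul, map_ofNat, map_one] using congrArg (algebraMap F[X] K) hc
  -- Multiply $2sg=\mathbf{Tr}(sg)+\mathbf{Tr}(g)s$ by $s/2$; both traces are polynomials because
  -- $A$ is integrally closed.
  refine ⟨Polynomial.C 2⁻¹ * (α * U), Polynomial.C 2⁻¹ * W, ?_⟩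
  have key := h.add_mul_eq (2 * s * g)
  have hs := h.sqrt_ne_zero
  rw [mul_div_cancel_left₀ _ (mul_ne_zero h2 hs), ← hU, ← hW,
    ← IsScalarTower.algebraMap_apply, ← IsScalarTower.algebraMap_apply] at key
  simp only [map_mul, hc', ← h.sq_eq]
  field_simp
  linear_combination key

/-! ### Counting and discreteness of integral elements -/

theorem mem_degreeLT_of_abs_sq_le (h : IsImaginaryQuadratic α s v) {U : F[X]} {n : ℕ}
    (hU : v (algebraMap F[X] K U) ^ 2 ≤ (Nat.card F : ℝ) ^ n) :
    U ∈ Polynomial.degreeLT F (n / 2 + 1) := by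
  rw [Polynomial.mem_degreeLT]
  rcases eq_or_ne U 0 with rfl | h0
  · rw [Polynomial.degree_zero]
    exact WithBot.bot_lt_coe _
  rw [h.abs_poly h0, ← pow_mul, pow_le_pow_iff_right₀ one_lt_card] at hU
  rw [Polynomial.degree_eq_natDegree h0]
  exact_mod_cast (by omega : U.natDegree < n / 2 + 1)

theorem finite_ballInt_and_ncard_le (h : IsImaginaryQuadratic α s v) (N : ℕ) :
    (ballInt F v N).Finite ∧
      (ballInt F v N).ncard ≤ Nat.card F ^ (2 * α.natDegree + N + 2) := by
  choose U W hUW using h.exists_algebraMap_mul_eq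
  -- The exponent bounding $|\alpha g|^2$. Both coordinates of $\alpha g$ have degree at most
  -- $\lfloor n/2\rfloor$, giving at most $q^{2(\lfloor n/2\rfloor+1)}\le q^{n+2}$ pairs.
  set n := 2 * α.natDegree + N with hn
  have hmem : ∀ g ∈ ballInt F v N, U g ∈ Polynomial.degreeLT F (n / 2 + 1) ∧
      W g ∈ Polynomial.degreeLT F (n / 2 + 1) := by
    intro g hg
    have hg' : v (algebraMap F[X] K α * g) ^ 2 ≤ (Nat.card F : ℝ) ^ n := by
      rw [map_mul, mul_pow, h.abs_poly h.ne_zero, ← pow_mul, hn, pow_add, mul_comm α.natDegree]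
      exact mul_le_mul_of_nonneg_left hg (by positivity)
    rw [hUW] at hg'
    have hmax := h.max_le_abs_add_mul (U g) (W g)
    refine ⟨h.mem_degreeLT_of_abs_sq_le (le_trans ?_ hg'),
      h.mem_degreeLT_of_abs_sq_le (le_trans ?_ hg')⟩
    · exact pow_le_pow_left₀ (v.nonneg _) ((le_max_left _ _).trans hmax) 2
    · refine pow_le_pow_left₀ (v.nonneg _) (le_trans ?_ ((le_max_right _ _).trans hmax)) 2
      rw [map_mul]
      exact le_mul_of_one_le_right (v.nonneg _) h.one_le_abs_sqrt
  have hfin : Finite (Polynomial.degreeLT F (n / 2 + 1)) :=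
    Finite.of_equiv _ (Polynomial.degreeLTEquiv F (n / 2 + 1)).toEquiv.symm
  let φ : ballInt F v N →
      Polynomial.degreeLT F (n / 2 + 1) × Polynomial.degreeLT F (n / 2 + 1) := fun g =>
    (⟨U g, (hmem g g.2).1⟩, ⟨W g, (hmem g g.2).2⟩)
  have hφ : Function.Injective φ := by
    intro g g' hgg
    have h1 : U g = U g' := congrArg (fun p => (p.1 : F[X])) hgg
    have h2 : W g = W g' := congrArg (fun p => (p.2 : F[X])) hgg
    have h3 := hUW g
    rw [h1, h2, ← hUW g'] at h3
    exact Subtype.ext (Subtype.ext (mul_left_cancel₀ h.algebraMap_ne_zero h3))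
  refine ⟨Set.finite_coe_iff.1 (Finite.of_injective φ hφ), ?_⟩
  rw [← Nat.card_coe_set_eq]
  refine (Nat.card_le_card_of_injective φ hφ).trans ?_
  rw [Nat.card_prod, card_degreeLT, ← pow_add]
  exact Nat.pow_le_pow_right Nat.card_pos (by omega)

theorem finite_ballInt (h : IsImaginaryQuadratic α s v) (N : ℕ) : (ballInt F v N).Finite :=
  (h.finite_ballInt_and_ncard_le N).1

/-- Some coordinate of $\alpha g$ is a nonzero polynomial, hence of absolute value at least 1, and
no coordinate can be cancelled by the other. -/
theorem one_le_card_pow_mul_abs (h : IsImaginaryQuadratic α s v) {g : Integers F K} (hg : g ≠ 0) :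
    1 ≤ (Nat.card F : ℝ) ^ α.natDegree * v g := by
  obtain ⟨U, W, hUW⟩ := h.exists_algebraMap_mul_eq g
  rw [← h.abs_poly h.ne_zero, ← map_mul, hUW]
  have hpoly : ∀ f : F[X], f ≠ 0 → 1 ≤ v (algebraMap F[X] K f) := fun f hf => by
    rw [h.abs_poly hf]
    exact one_le_pow₀ one_le_card
  refine le_trans ?_ (h.max_le_abs_add_mul U W)
  rcases eq_or_ne U 0 with rfl | hU
  · have hW : W ≠ 0 := by
      rintro rfl
      rw [map_zero, zero_mul, add_zero, mul_eq_zero] at hUW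
      exact hg (Subtype.ext (hUW.resolve_left h.algebraMap_ne_zero))
    refine le_max_of_le_right ?_
    rw [map_mul]
    exact one_le_mul_of_one_le_of_one_le (hpoly W hW) h.one_le_abs_sqrt
  · exact le_max_of_le_left (hpoly U hU)

/-! ### Characters of balls and separation of fractions -/

/-- The additive group `{g ∈ 𝔸 : N(g) ≤ q ^ N}`. -/
def ballSubgroup (h : IsImaginaryQuadratic α s v) (N : ℕ) : AddSubgroup (Integers F K) where
  carrier := ballInt F v N
  zero_mem' := by simp [ballInt, sizeN]
  add_mem' := by
    intro x y hx hy
    simp only [ballInt, sizeN, Set.mem_ofPred_eq] at hx hy ⊢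
    refine (pow_le_pow_left₀ (v.nonneg _) (h.abs_add_le_max x y) 2).trans ?_
    rcases max_choice (v (x : K)) (v (y : K)) with hm | hm <;> rw [hm] <;> assumption
  neg_mem' := by
    intro x hx
    simpa [ballInt, sizeN] using hx

/-- The character `g ↦ e(Tr(g y))` of the group `{g ∈ 𝔸 : N(g) ≤ q ^ N}`. -/
noncomputable def traceChar (h : IsImaginaryQuadratic α s v) (N : ℕ) (y : K) :
    AddChar (h.ballSubgroup N) ℂ where
  toFun g := charInf F (toKInf F (Algebra.trace (RatFunc F) K ((g : Integers F K) * y)))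
  map_zero_eq_one' := by simp [charInf_zero]
  map_add_eq_mul' x y := by simp [add_mul, charInf_add]

theorem traceChar_apply (h : IsImaginaryQuadratic α s v) (N : ℕ) (y : K) (g : h.ballSubgroup N) :
    h.traceChar N y g =
      charInf F (toKInf F (Algebra.trace (RatFunc F) K ((g : Integers F K) * y))) := rfl

theorem traceChar_add (h : IsImaginaryQuadratic α s v) (N : ℕ) (y z : K) :
    h.traceChar N (y + z) = h.traceChar N y * h.traceChar N z := by
  ext g
  simp [traceChar_apply, mul_add, charInf_add]

/-- If `g ↦ e(Tr(g x / (2 √α)))` is trivial on a large ball, then `x` is close to `𝔸`. -/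
theorem exists_abs_sub_sq_mul_le (h : IsImaginaryQuadratic α s v) {J N : ℕ}
    (hN : 2 * J + α.natDegree ≤ N) {x : K} (hx : h.traceChar N (x / (2 * s)) = 1) :
    ∃ w : Integers F K, v (x - w) ^ 2 * (Nat.card F : ℝ) ^ (2 * (J + 1)) ≤
      (Nat.card F : ℝ) ^ α.natDegree := by
  have hq : (0 : ℝ) < Nat.card F := zero_lt_one.trans one_lt_card
  set S : Integers F K := ⟨s, h.isIntegral_sqrt⟩
  set z := x / (2 * s) with hz
  have habs : ∀ j < J, ∀ c, v (algebraMap F[X] K (Polynomial.monomial j c)) ^ 2 ≤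
      (Nat.card F : ℝ) ^ (2 * J) := by
    intro j hj c
    rcases eq_or_ne c 0 with rfl | hc
    · simp
    · rw [h.abs_poly (by simpa using hc), ← pow_mul, Polynomial.natDegree_monomial_eq _ hc]
      exact pow_le_pow_right₀ one_le_card (by omega)
  have hchar : ∀ g ∈ ballInt F v N,
      charInf F (toKInf F (Algebra.trace (RatFunc F) K ((g : K) * z))) = 1 := by
    intro g hg
    simpa [traceChar_apply] using DFunLike.congr_fun hx (⟨g, hg⟩ : h.ballSubgroup N)
  -- Testing on $g=ct^j$ controls $\mathbf{Tr}(z)$, the $s$-coordinate of $x$.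
  obtain ⟨f₁, hf₁⟩ := exists_absInf_sub_le (J := J)
    (x := toKInf F (Algebra.trace (RatFunc F) K z)) fun j hj c => by
    have hmem : algebraMap F[X] (Integers F K) (Polynomial.monomial j c) ∈ ballInt F v N :=
      (habs j hj c).trans (pow_le_pow_right₀ one_le_card (by omega))
    rw [← hchar _ hmem, ← toKInf_algebraMap, ← map_mul, ← trace_algebraMap_mul,
      ← IsScalarTower.algebraMap_apply]
    rfl
  -- Testing on $g=ct^js$ controls $\mathbf{Tr}(sz)$, the other coordinate; these $g$ have norm at
  -- most $q^{2J+l}$, hence the hypothesis on $N$.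
  obtain ⟨f₂, hf₂⟩ := exists_absInf_sub_le (J := J)
    (x := toKInf F (Algebra.trace (RatFunc F) K (s * z))) fun j hj c => by
    have hmem : algebraMap F[X] (Integers F K) (Polynomial.monomial j c) * S ∈ ballInt F v N := by
      change v (algebraMap F[X] K (Polynomial.monomial j c) * s) ^ 2 ≤ _
      rw [map_mul, mul_pow, h.abs_sqrt_sq]
      refine (mul_le_mul_of_nonneg_right (habs j hj c) (by positivity)).trans ?_
      rw [← pow_add]
      exact pow_le_pow_right₀ one_le_card hN
    rw [← hchar _ hmem, ← toKInf_algebraMap, ← map_mul, ← trace_algebraMap_mul,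
      ← IsScalarTower.algebraMap_apply, ← mul_assoc]
    rfl
  rw [← toKInf_algebraMap, ← map_sub, ← h.abs_algebraMap] at hf₁ hf₂
  set e₁ := algebraMap (RatFunc F) K
    (Algebra.trace (RatFunc F) K z - algebraMap F[X] (RatFunc F) f₁) with he₁
  set e₂ := algebraMap (RatFunc F) K
    (Algebra.trace (RatFunc F) K (s * z) - algebraMap F[X] (RatFunc F) f₂) with he₂
  refine ⟨algebraMap F[X] (Integers F K) f₂ + algebraMap F[X] (Integers F K) f₁ * S, ?_⟩
  have hdiff : x - (algebraMap F[X] (Integers F K) f₂ + algebraMap F[X] (Integers F K) f₁ * S :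
      Integers F K) = e₂ + e₁ * s := by
    change x - (algebraMap F[X] K f₂ + algebraMap F[X] K f₁ * s) = _
    rw [he₁, he₂, map_sub, map_sub, ← IsScalarTower.algebraMap_apply,
      ← IsScalarTower.algebraMap_apply]
    linear_combination h.add_mul_eq x
  have hle : v (e₂ + e₁ * s) ≤ (Nat.card F : ℝ) ^ (-((J : ℤ) + 1)) * v s := by
    refine (h.abs_add_le_max _ _).trans (max_le ?_ ?_)
    · exact hf₂.trans (le_mul_of_one_le_right (by positivity) h.one_le_abs_sqrt)
    · rw [map_mul]
      exact mul_le_mul_of_nonneg_right hf₁ (v.nonneg _)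
  have hcancel : (Nat.card F : ℝ) ^ (-((J : ℤ) + 1)) * (Nat.card F : ℝ) ^ (J + 1) = 1 := by
    rw [← zpow_natCast, ← zpow_add₀ hq.ne']
    simp
  rw [hdiff, mul_comm 2, pow_mul, ← mul_pow, ← h.abs_sqrt_sq]
  refine pow_le_pow_left₀ (by positivity) ?_ 2
  calc v (e₂ + e₁ * s) * (Nat.card F : ℝ) ^ (J + 1)
      ≤ (Nat.card F : ℝ) ^ (-((J : ℤ) + 1)) * v s * (Nat.card F : ℝ) ^ (J + 1) :=
        mul_le_mul_of_nonneg_right hle (by positivity)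
    _ = v s := by linear_combination v s * hcancel

/-- Two fractions with the same character on a large ball agree modulo `𝔸`. -/
theorem exists_mul_sub_mul_eq (h : IsImaginaryQuadratic α s v) {Q N : ℕ}
    (hN : 2 * Q + 5 * α.natDegree ≤ N) {f f' r r' : Integers F K} (hf : f ∈ moduli F v Q)
    (hf' : f' ∈ moduli F v Q)
    (hψ : h.traceChar N (r / (2 * s * f)) = h.traceChar N (r' / (2 * s * f'))) :
    ∃ w : Integers F K, r * f' - r' * f = w * (f * f') := by
  have hq : (0 : ℝ) < Nat.card F := zero_lt_one.trans one_lt_card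
  have h0 : (f : K) ≠ 0 := fun h0 => hf.1 (Subtype.ext h0)
  have h0' : (f' : K) ≠ 0 := fun h0 => hf'.1 (Subtype.ext h0)
  have hs := h.sqrt_ne_zero
  have h2 := h.two_ne_zero_field
  set x : K := r / f - r' / f' with hx
  have htriv : h.traceChar N (x / (2 * s)) = 1 := by
    have e : (r / (2 * s * f) : K) = x / (2 * s) + r' / (2 * s * f') := by
      rw [hx]
      field_simp
      ring
    rw [e, traceChar_add] at hψ
    ext g
    have hg := DFunLike.congr_fun hψ g
    rw [AddChar.mul_apply] at hg
    exact (mul_eq_right₀ (AddChar.val_isUnit _ g).ne_zero).1 hg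
  -- With this $J$, $2J+l=2Q+5l\le N$. The integral element $D=ff'(x-w)$ has $|D|^2\le
  -- q^{2Q+l-2(J+1)}=q^{-3l-2}$, whereas $D\ne0$ would require $|D|^2\ge q^{-2l}$.
  obtain ⟨w, hw⟩ := h.exists_abs_sub_sq_mul_le
    (J := Q + 2 * α.natDegree) (by omega) htriv
  refine ⟨w, ?_⟩
  rw [← sub_eq_zero]
  by_contra hne
  have h1 := h.one_le_card_pow_mul_abs hne
  have e : ((r * f' - r' * f - w * (f * f') : Integers F K) : K) = f * f' * (x - w) := by
    rw [hx]
    push_cast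
    field_simp
  rw [e, map_mul, map_mul] at h1
  have h1 := one_le_pow₀ (n := 2) h1
  have hF : v f ^ 2 = (Nat.card F : ℝ) ^ Q := hf.2
  have hF' : v f' ^ 2 = (Nat.card F : ℝ) ^ Q := hf'.2
  rw [mul_pow, mul_pow, mul_pow, hF, hF'] at h1
  have hA : (0 : ℝ) < (Nat.card F : ℝ) ^ α.natDegree := by positivity
  set q := (Nat.card F : ℝ)
  have h3 : q ^ (2 * (Q + 2 * α.natDegree + 1)) =
      q ^ Q * q ^ Q * (q ^ α.natDegree) ^ 4 * q ^ 2 := by ring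
  rw [h3] at hw
  have h4 : (q ^ α.natDegree) ^ 2 * q ^ 2 ≤ q ^ α.natDegree := by
    refine le_trans ?_ hw
    have : (q ^ α.natDegree) ^ 2 * q ^ 2 * 1 ≤ (q ^ α.natDegree) ^ 2 * q ^ 2 *
        ((q ^ α.natDegree) ^ 2 * (q ^ Q * q ^ Q * v (x - w) ^ 2)) :=
      mul_le_mul_of_nonneg_left h1 (by positivity)
    linarith
  have h5 : 1 ≤ q ^ α.natDegree := one_le_pow₀ one_le_card
  have h6 : 1 < q ^ 2 := one_lt_pow₀ one_lt_card _root_.two_ne_zero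
  nlinarith [mul_lt_mul_of_pos_left h6 (pow_pos hA 2)]

end IsImaginaryQuadratic

/-- Two reduced fractions that agree modulo `R` have associated denominators. -/
theorem dvd_of_mul_sub_mul_eq {R : Type*} [CommRing R] {f f' r r' w : R} (hr : IsCoprime r f)
    (h : r * f' - r' * f = w * (f * f')) : f ∣ f' :=
  hr.symm.dvd_of_dvd_mul_left ⟨r' + w * f', by linear_combination h⟩

theorem finsum_mem_eq_sum_ite {G M : Type*} [AddCommGroup G] [AddCommMonoid M] (H : AddSubgroup G)
    [Fintype H] {B : Set G} (hB : B ⊆ H) (c : G → M) [DecidablePred (· ∈ B)] :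
    ∑ᶠ g ∈ B, c g = ∑ g : H, if (g : G) ∈ B then c g else 0 := by
  rw [← finsum_eq_sum_of_fintype]
  refine Eq.trans (finsum_congr fun g => ?_) (finsum_set_coe_eq_finsum_mem
    (s := (H : Set G)) (f := fun g => if g ∈ B then c g else 0)).symm
  by_cases hg : g ∈ B
  · simp [hg, show g ∈ H from hB hg]
  · simp [hg]

/-! ### Multiplicity of characters and the final inequality -/

namespace IsImaginaryQuadratic

variable {F : Type*} [Field F] {K : Type*} [Field K] [Algebra (RatFunc F) K]
  [Algebra F[X] K] {α : F[X]} {s : K} {v : AbsoluteValue K ℝ}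
  [IsScalarTower F[X] (RatFunc F) K] [Finite F]

theorem finite_ballSubgroup (h : IsImaginaryQuadratic α s v) (N : ℕ) : Finite (h.ballSubgroup N) :=
  Set.finite_coe_iff.2 (h.finite_ballInt N)

theorem finite_moduli (h : IsImaginaryQuadratic α s v) (Q : ℕ) : (moduli F v Q).Finite :=
  (h.finite_ballInt Q).subset fun _ hf => hf.2.le

theorem eq_of_traceChar_eq (h : IsImaginaryQuadratic α s v) {Q N : ℕ}
    (hN : 2 * Q + 5 * α.natDegree ≤ N) {f r r' : Integers F K} {S : Set (Integers F K)}
    (hS : IsReducedResidueSystem f S) (hf : f ∈ moduli F v Q) (hr : r ∈ S) (hr' : r' ∈ S)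
    (hψ : h.traceChar N (r / (2 * s * f)) = h.traceChar N (r' / (2 * s * f))) : r = r' := by
  obtain ⟨w, hw⟩ := h.exists_mul_sub_mul_eq hN hf hf hψ
  have hdvd : f ∣ r - r' := ⟨w, mul_right_cancel₀ hf.1 (by linear_combination hw)⟩
  exact (hS.2 r (hS.1 r hr)).unique ⟨hr, by simp⟩ ⟨hr', hdvd⟩

/-- The residues inject into the finite dual of a sufficiently large ball. -/
theorem finite_of_isReducedResidueSystem (h : IsImaginaryQuadratic α s v) {Q : ℕ}
    {f : Integers F K} {S : Set (Integers F K)} (hS : IsReducedResidueSystem f S)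
    (hf : f ∈ moduli F v Q) : S.Finite := by
  have := h.finite_ballSubgroup (2 * Q + 5 * α.natDegree)
  refine Set.Finite.of_injOn
    (f := fun r : Integers F K => h.traceChar (2 * Q + 5 * α.natDegree) (r / (2 * s * f)))
    (Set.mapsTo_univ _ _) (fun r hr r' hr' hψ => ?_) Set.finite_univ
  exact h.eq_of_traceChar_eq le_rfl hS hf hr hr' hψ

/-- On a large ball each character comes from a bounded number of reduced fractions. -/
theorem ncard_traceChar_eq_le (h : IsImaginaryQuadratic α s v) {Q N : ℕ}
    (hN : 2 * Q + 5 * α.natDegree ≤ N) {S : Integers F K → Set (Integers F K)}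
    (hS : ∀ f, f ≠ 0 → IsReducedResidueSystem f (S f))
    {T : Set (Σ _ : Integers F K, Integers F K)}
    (hT : ∀ p ∈ T, p.1 ∈ moduli F v Q ∧ p.2 ∈ S p.1) {p : Σ _ : Integers F K, Integers F K}
    (hp : p ∈ T) :
    Set.ncard {p' ∈ T | h.traceChar N (p'.2 / (2 * s * p'.1)) =
      h.traceChar N (p.2 / (2 * s * p.1))} ≤ Nat.card F ^ (2 * α.natDegree + 2) := by
  obtain ⟨hf, hr⟩ := hT p hp
  have hdvd : ∀ p' ∈ {p' ∈ T | h.traceChar N (p'.2 / (2 * s * p'.1)) =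
      h.traceChar N (p.2 / (2 * s * p.1))}, p.1 ∣ p'.1 := by
    rintro p' ⟨hp', hψ⟩
    obtain ⟨w, hw⟩ := h.exists_mul_sub_mul_eq hN hf (hT p' hp').1 hψ.symm
    exact dvd_of_mul_sub_mul_eq ((hS _ hf.1).1 _ hr) hw
  -- The cofactor $u=f'/f$ has norm $q^0$, and it determines $f'$, which together with the common
  -- character determines $r'$.
  choose! u hu using hdvd
  refine (Set.ncard_le_ncard_of_injOn u ?_ ?_ (h.finite_ballInt 0)).trans
    (h.finite_ballInt_and_ncard_le 0).2
  · intro p' hp'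
    have hf' := (hT p' hp'.1).1.2
    rw [hu p' hp', sizeN, Subalgebra.coe_mul, map_mul, mul_pow, show v p.1 ^ 2 = _ from hf.2,
      mul_eq_left₀ (pow_pos (zero_lt_one.trans one_lt_card) _).ne'] at hf'
    exact (hf'.trans (pow_zero _).symm).le
  · rintro ⟨f₁, r₁⟩ h₁ ⟨f₂, r₂⟩ h₂ h12
    have hff : f₁ = f₂ := by
      have e₁ := hu _ h₁
      have e₂ := hu _ h₂
      rw [h12] at e₁
      exact e₁.trans e₂.symm
    subst hff
    obtain ⟨hf₁, hr₁⟩ := hT _ h₁.1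
    exact congrArg (Sigma.mk f₁)
      (h.eq_of_traceChar_eq hN (hS f₁ hf₁.1) hf₁ hr₁ (hT _ h₂.1).2 (h₁.2.trans h₂.2.symm))

theorem large_sieve (h : IsImaginaryQuadratic α s v) {S : Integers F K → Set (Integers F K)}
    (hS : ∀ f, f ≠ 0 → IsReducedResidueSystem f (S f)) (Q N : ℕ) (a : Integers F K → ℂ) :
    ∑ᶠ f ∈ moduli F v Q, ∑ᶠ r ∈ S f, ‖∑ᶠ g ∈ ballInt F v N, a g * charInf F (toKInf F
        (Algebra.trace (RatFunc F) K ((g : K) * (r : K) / (2 * s * (f : K)))))‖ ^ 2 ≤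
      (Nat.card F : ℝ) ^ (9 * α.natDegree + 4) *
        ((Nat.card F : ℝ) ^ (2 * Q) + (Nat.card F : ℝ) ^ N) * ∑ᶠ g ∈ ballInt F v N, ‖a g‖ ^ 2 := by
  classical
  -- The ball is enlarged until its characters separate fractions; as $q^{N'}\le
  -- q^{5l}(q^{2Q}+q^N)$, this only affects the constant.
  set N' := max N (2 * Q + 5 * α.natDegree) with hN'
  have hN : 2 * Q + 5 * α.natDegree ≤ N' := le_max_right _ _
  have := h.finite_ballSubgroup N'
  have := Fintype.ofFinite (h.ballSubgroup N')
  have hB : ballInt F v N ⊆ h.ballSubgroup N' := fun g hg =>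
    le_trans (show sizeN v (g : K) ≤ _ from hg) (pow_le_pow_right₀ one_le_card (le_max_left _ _))
  have hfin : ∀ f, ∃ t : Finset (Integers F K), f ∈ moduli F v Q → S f = t := by
    intro f
    by_cases hf : f ∈ moduli F v Q
    · exact ⟨(h.finite_of_isReducedResidueSystem (hS f hf.1) hf).toFinset, fun _ => by simp⟩
    · exact ⟨∅, fun hf' => absurd hf' hf⟩
  choose t ht using hfin
  set b : h.ballSubgroup N' → ℂ := fun g => if (g : Integers F K) ∈ ballInt F v N then a g else 0
    with hb
  set T := (h.finite_moduli Q).toFinset.sigma t with hT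
  have hTmem : ∀ p ∈ (T : Set (Σ _ : Integers F K, Integers F K)),
      p.1 ∈ moduli F v Q ∧ p.2 ∈ S p.1 := by
    intro p hp
    rw [Finset.mem_coe, hT, Finset.mem_sigma, Set.Finite.mem_toFinset] at hp
    exact ⟨hp.1, by rw [ht _ hp.1]; exact hp.2⟩
  have hlhs : ∑ᶠ f ∈ moduli F v Q, ∑ᶠ r ∈ S f,
      ‖∑ᶠ g ∈ ballInt F v N, a g * charInf F (toKInf F
        (Algebra.trace (RatFunc F) K ((g : K) * (r : K) / (2 * s * (f : K)))))‖ ^ 2 =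
      ∑ p ∈ T, ‖∑ g, b g * h.traceChar N' (p.2 / (2 * s * p.1)) g‖ ^ 2 := by
    rw [finsum_mem_eq_finite_toFinset_sum _ (h.finite_moduli Q), hT, Finset.sum_sigma]
    refine Finset.sum_congr rfl fun f hf => ?_
    rw [ht f ((h.finite_moduli Q).mem_toFinset.1 hf), finsum_mem_coe_finset]
    refine Finset.sum_congr rfl fun r _ => ?_
    rw [finsum_mem_eq_sum_ite (h.ballSubgroup N') hB]
    simp only [hb, traceChar_apply, ite_mul, zero_mul, mul_div_assoc]
  have hrhs : ∑ᶠ g ∈ ballInt F v N, ‖a g‖ ^ 2 = ∑ g, ‖b g‖ ^ 2 := by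
    rw [finsum_mem_eq_sum_ite (h.ballSubgroup N') hB]
    refine Finset.sum_congr rfl fun g _ => ?_
    simp only [hb]
    split_ifs <;> simp
  have hcard : (Fintype.card (h.ballSubgroup N') : ℝ) ≤
      (Nat.card F : ℝ) ^ (2 * α.natDegree + N' + 2) := by
    rw [← Nat.card_eq_fintype_card]
    exact_mod_cast (Nat.card_coe_set_eq _).le.trans (h.finite_ballInt_and_ncard_le N').2
  have hpow : (Nat.card F : ℝ) ^ N' ≤ (Nat.card F : ℝ) ^ (5 * α.natDegree) *
      ((Nat.card F : ℝ) ^ (2 * Q) + (Nat.card F : ℝ) ^ N) := by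
    have h1 : (1 : ℝ) ≤ (Nat.card F : ℝ) ^ (5 * α.natDegree) := one_le_pow₀ one_le_card
    have h2 : (0 : ℝ) ≤ (Nat.card F : ℝ) ^ N := by positivity
    have h3 : (0 : ℝ) ≤ (Nat.card F : ℝ) ^ (2 * Q) := by positivity
    rcases max_choice N (2 * Q + 5 * α.natDegree) with hm | hm
    · rw [hN', hm]
      nlinarith
    · rw [hN', hm, pow_add]
      nlinarith
  rw [hlhs, hrhs]
  refine (sum_norm_sq_sum_mul_le T (fun p => h.traceChar N' (p.2 / (2 * s * p.1)))
    (Nat.card F ^ (2 * α.natDegree + 2))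
    (fun p hp => h.ncard_traceChar_eq_le hN hS hTmem hp) b).trans ?_
  rw [← mul_assoc]
  refine mul_le_mul_of_nonneg_right ?_ (by positivity)
  push_cast
  calc (Nat.card F : ℝ) ^ (2 * α.natDegree + 2) * (Fintype.card (h.ballSubgroup N') : ℝ)
      ≤ (Nat.card F : ℝ) ^ (2 * α.natDegree + 2) *
        (Nat.card F : ℝ) ^ (2 * α.natDegree + N' + 2) := by gcongr
    _ = (Nat.card F : ℝ) ^ (4 * α.natDegree + 4) * (Nat.card F : ℝ) ^ N' := by ring
    _ ≤ (Nat.card F : ℝ) ^ (4 * α.natDegree + 4) * ((Nat.card F : ℝ) ^ (5 * α.natDegree) *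
        ((Nat.card F : ℝ) ^ (2 * Q) + (Nat.card F : ℝ) ^ N)) := by gcongr
    _ = _ := by ring

end IsImaginaryQuadratic

end QuadLargeSieve

open QuadLargeSieve in
theorem theorem1 (q : ℕ) (hq : Odd q) (l : ℕ) :
    ∃ C : ℝ, 0 < C ∧
      ∀ (F : Type*) [Field F] [Finite F] (_hF : Nat.card F = q)
        (α : F[X]) (_hα : Squarefree α) (_hl : α.natDegree = l)
        (_him : Odd α.natDegree ∨ ¬ IsSquare α.leadingCoeff)
        -- `K = k(√α)` with `k = F(t)`; `s` is `√α`
        (K : Type*) [Field K] [Algebra F[X] K] [Algebra (RatFunc F) K]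
        [IsScalarTower F[X] (RatFunc F) K]
        (s : K) (_hs : s ^ 2 = algebraMap F[X] K α)
        (_hK : IntermediateField.adjoin (RatFunc F) {s} = ⊤)
        -- the absolute value of `K` at the fixed place above `∞`
        (v : AbsoluteValue K ℝ)
        (_hv : ∀ x : RatFunc F, v (algebraMap (RatFunc F) K x) = absInf F (toKInf F x))
        -- for each modulus `f`, representatives of the classes `r mod f` with `(r, f) = 1`
        (S : Integers F K → Set (Integers F K))
        (_hS : ∀ f : Integers F K, f ≠ 0 → IsReducedResidueSystem f (S f))
        (Q N : ℕ) (a : Integers F K → ℂ),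
        (moduli F v Q).Finite ∧ (∀ f ∈ moduli F v Q, (S f).Finite) ∧ (ballInt F v N).Finite ∧
        ∑ᶠ f ∈ moduli F v Q, ∑ᶠ r ∈ S f,
            ‖∑ᶠ g ∈ ballInt F v N, a g * charInf F (toKInf F
              (Algebra.trace (RatFunc F) K ((g : K) * (r : K) / (2 * s * (f : K)))))‖ ^ 2 ≤
          C * ((q : ℝ) ^ (2 * Q) + (q : ℝ) ^ N) * ∑ᶠ g ∈ ballInt F v N, ‖a g‖ ^ 2 := by
  have hq0 : (0 : ℝ) < q := by exact_mod_cast hq.pos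
  -- Multiplicity $q^{2l+2}$, times $q^{2l+2}$ from the size of the ball, times $q^{5l}$ from
  -- enlarging it.
  refine ⟨(q : ℝ) ^ (9 * l + 4), by positivity, ?_⟩
  intro F _ _ hF α hα hl him K _ _ _ _ s hs hK v hv S hS Q N a
  have h2 : (2 : F) ≠ 0 := by
    have := Fintype.ofFinite F
    refine Ring.two_ne_zero fun hchar => ?_
    have h2 := FiniteField.even_card_of_char_two hchar
    rw [← Nat.card_eq_fintype_card, hF] at h2
    have := Nat.odd_iff.1 hq
    omega
  have h : IsImaginaryQuadratic α s v := ⟨h2, hα.ne_zero, him, hs, hK, hv⟩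
  -- A `finsum` with infinite support is 0 by convention; the finiteness claims ensure that the
  -- inequality concerns the actual sums.
  refine ⟨h.finite_moduli Q,
    fun f hf => h.finite_of_isReducedResidueSystem (hS f hf.1) hf, h.finite_ballInt N, ?_⟩
  rw [← hF, ← hl]
  exact h.large_sieve hS Q N a
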